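/- **Theorem 1.1.** Let $G$ be a topological group. Call a map $f\colon[0,1]\to G$ *strongly measurable* if for every $\varepsilon>0$ there is a closed set $A\subseteq[0,1]$ with $\lambda([0,1]\setminus A)\le\varepsilon$ such that $f|_A$ is continuous, where $\lambda$ is Lebesgue measure. Let $L^0(G)$ be the group, under pointwise multiplication, of strongly measurable maps $[0,1]\to G$ modulo equality $\lambda$-almost everywhere, with the topology of convergence in measure: this is the group topology in which the sets $$N(U,\varepsilon)=\{f\in L^0(G)\mid \lambda(\{x\in[0,1]\mid f(x)\notin U\})<\varepsilon\},$$ for $U$ an open neighbourhood of $e$ in $G$ and $\varepsilon>0$, form a neighbourhood basis of the neutral element. The following are equivalent. 1. $G$ is amenable. 2. $L^0(G)$ is amenable. 3. $L^0(G)$ is extremely amenable. 4. $L^0(G)$ is whirly amenable. Here a topological group $H$ is *amenable* if there is a positive linear functional $m$ with $m(\mathbf 1)=1$ on the space $\mathrm{RUC}_b(H)$ of bounded real-valued functions on $H$ that are uniformly continuous for the right uniformity (with basic entourages $\{(x,y)\mid xy^{-1}\in U\}$, $U$ a neighbourhood of $e$) such that $m(x\mapsto f(hx))=m(f)$ for all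 $f\in\mathrm{RUC}_b(H)$ and $h\in H$. It is *extremely amenable* if every continuous action of $H$ on a non-empty compact Hausdorff space has a fixed point. It is *whirly amenable* if it is amenable and, for every continuous action of $H$ on a compact Hausdorff space, every $H$-invariant regular Borel probability measure is supported on the set of fixed points. -/

import Mathlib

open MeasureTheory Set Filter Topology unitInterval
open scoped ENNReal Pointwise

universe u v

section Amenability

variable (G : Type u) [Group G] [TopologicalSpace G] [IsTopologicalGroup G]

/-- `RUC_b(G)`: the space of bounded real-valued functions on `G` that are uniformly continuous
for the right uniformity of `G`, whose basic entourages are the sets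
`{(x, y) | x * y⁻¹ ∈ U}` with `U` a neighbourhood of `1`. -/
def RUCb : Submodule ℝ (G → ℝ) where
  carrier := {f | (∃ C : ℝ, ∀ x, |f x| ≤ C) ∧
    @UniformContinuous G ℝ (IsTopologicalGroup.rightUniformSpace G) _ f}
  zero_mem' := by
    let := IsTopologicalGroup.rightUniformSpace G
    exact ⟨⟨0, fun x => by simp⟩, uniformContinuous_const⟩
  add_mem' := by
    let := IsTopologicalGroup.rightUniformSpace G
    rintro f g ⟨⟨C, hC⟩, hf⟩ ⟨⟨D, hD⟩, hg⟩
    exact ⟨⟨C + D, fun x => (abs_add_le _ _).trans (add_le_add (hC x) (hD x))⟩, hf.add hg⟩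
  smul_mem' := by
    let := IsTopologicalGroup.rightUniformSpace G
    rintro c f ⟨⟨C, hC⟩, hf⟩
    refine ⟨⟨|c| * C, fun x => ?_⟩, hf.const_smul c⟩
    simpa [abs_mul] using mul_le_mul_of_nonneg_left (hC x) (abs_nonneg c)

variable {G}

/-- The constant function `1` as an element of `RUC_b(G)`. -/
def RUCb.one : RUCb G :=
  ⟨fun _ => 1, by
    let := IsTopologicalGroup.rightUniformSpace G
    exact ⟨⟨1, fun x => by simp⟩, uniformContinuous_const⟩⟩

/-- The left translate `f ∘ λ_g : x ↦ f (g * x)` of `f ∈ RUC_b(G)`. -/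
def RUCb.translate (g : G) (f : RUCb G) : RUCb G :=
  ⟨fun x => f.1 (g * x), by
    let := IsTopologicalGroup.rightUniformSpace G
    refine ⟨⟨f.2.1.choose, fun x => f.2.1.choose_spec _⟩, f.2.2.comp ?_⟩
    have h : Tendsto (fun z : G => g * z * g⁻¹) (𝓝 1) (𝓝 1) := by
      have : Continuous fun z : G => g * z * g⁻¹ := by fun_prop
      simpa using this.tendsto 1
    refine tendsto_comap_iff.2 ?_
    have h2 := h.comp (tendsto_comap (f := fun p : G × G => p.2 * p.1⁻¹) (x := 𝓝 1))
    refine h2.congr fun p => ?_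
    simp [mul_assoc]⟩

variable (G)

/-- A topological group is amenable if `RUC_b(G)` admits a left-invariant mean. -/
def IsAmenableGroup : Prop :=
  ∃ m : RUCb G →ₗ[ℝ] ℝ,
    (∀ f : RUCb G, (∀ x, 0 ≤ f.1 x) → 0 ≤ m f) ∧
    m RUCb.one = 1 ∧
    ∀ (g : G) (f : RUCb G), m (RUCb.translate g f) = m f

/-- A topological group `G` is extremely amenable if every (jointly continuous) action of `G` on
a nonempty compact Hausdorff space has a fixed point. The spaces range over the universe
`max u v`, with `v` arbitrary; in particular over all spaces in the universe of `G`. -/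
def IsExtremelyAmenable : Prop :=
  ∀ (X : Type (max u v)) [TopologicalSpace X] [CompactSpace X] [T2Space X] [Nonempty X]
    [MulAction G X] [ContinuousSMul G X], (MulAction.fixedPoints G X).Nonempty

/-- A topological group `G` is whirly amenable if it is amenable and every `G`-invariant regular
Borel probability measure on a compact Hausdorff `G`-space is supported on the set of fixed
points. (The set of fixed points is closed, so this means that its complement is null.) -/
def IsWhirlyAmenable : Prop :=
  IsAmenableGroup G ∧
  ∀ (X : Type (max u v)) [TopologicalSpace X] [CompactSpace X] [T2Space X]
    [MulAction G X] [ContinuousSMul G X] [MeasurableSpace X] [BorelSpace X]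
    (μ : Measure X) [IsProbabilityMeasure μ] [μ.Regular] [SMulInvariantMeasure G X μ],
    μ (MulAction.fixedPoints G X)ᶜ = 0

end Amenability

/-- Strong measurability in the sense of Bourbaki and Lusin: for every `ε > 0` the map is
continuous on a closed set whose complement has measure at most `ε`. -/
def LusinMeasurable {X : Type*} {Y : Type*} [TopologicalSpace X] [MeasurableSpace X]
    [TopologicalSpace Y] (μ : Measure X) (f : X → Y) : Prop :=
  ∀ ε : ℝ≥0∞, 0 < ε → ∃ A : Set X, IsClosed A ∧ μ Aᶜ ≤ ε ∧ ContinuousOn f A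

section LZero

variable (G : Type u) [Group G] [TopologicalSpace G] [IsTopologicalGroup G]

/-- The group of strongly measurable maps from `[0,1]`, with Lebesgue measure, to `G`, under
pointwise multiplication. -/
def lusinMaps : Subgroup (I → G) where
  carrier := {f | LusinMeasurable volume f}
  one_mem' := fun _ _ => ⟨univ, isClosed_univ, by simp, continuousOn_const⟩
  mul_mem' := by
    intro f g hf hg ε hε
    obtain ⟨A, hA, hA', hfA⟩ := hf (ε / 2) (ENNReal.half_pos hε.ne')
    obtain ⟨B, hB, hB', hgB⟩ := hg (ε / 2) (ENNReal.half_pos hε.ne')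
    refine ⟨A ∩ B, hA.inter hB, ?_,
      (hfA.mono inter_subset_left).mul (hgB.mono inter_subset_right)⟩
    rw [compl_inter, ← ENNReal.add_halves ε]
    exact (measure_union_le _ _).trans (add_le_add hA' hB')
  inv_mem' := by
    intro f hf ε hε
    obtain ⟨A, hA, hA', hfA⟩ := hf ε hε
    exact ⟨A, hA, hA', hfA.inv⟩

/-- The strongly measurable maps that are equal to `1` almost everywhere. -/
def nullMaps : Subgroup (lusinMaps G) where
  carrier := {f | ∀ᵐ x : I, f.1 x = 1}
  one_mem' := by simp
  mul_mem' := by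
    intro f g hf hg
    change ∀ᵐ x : I, (f * g).1 x = 1
    filter_upwards [mem_ofPred_eq ▸ hf, mem_ofPred_eq ▸ hg] with x hx hy
    simp [hx, hy]
  inv_mem' := by
    intro f hf
    change ∀ᵐ x : I, (f⁻¹).1 x = 1
    filter_upwards [mem_ofPred_eq ▸ hf] with x hx
    simp [hx]

theorem mem_nullMaps {f : lusinMaps G} : f ∈ nullMaps G ↔ ∀ᵐ x : I, f.1 x = 1 :=
  Iff.rfl

instance nullMaps_normal : (nullMaps G).Normal where
  conj_mem := by
    intro f hf g
    rw [mem_nullMaps] at hf ⊢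
    filter_upwards [hf] with x hx
    simp [hx]

/-- `L⁰(G)`: classes of strongly measurable maps `[0,1] → G` modulo equality almost everywhere. -/
def LZero : Type u := lusinMaps G ⧸ nullMaps G

namespace LZero

instance : Group (LZero G) := inferInstanceAs (Group (lusinMaps G ⧸ nullMaps G))

variable {G}

/-- The class in `L⁰(G)` of a strongly measurable map. -/
def mk : lusinMaps G →* LZero G := QuotientGroup.mk' (nullMaps G)

theorem mk_surjective : Function.Surjective (mk (G := G)) :=
  QuotientGroup.mk'_surjective _

theorem mk_eq_mk {f g : lusinMaps G} : mk f = mk g ↔ ∀ᵐ x : I, f.1 x = g.1 x := by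
  refine QuotientGroup.eq.trans ((mem_nullMaps G).trans ?_)
  refine eventually_congr (Eventually.of_forall fun x => ?_)
  exact inv_mul_eq_one

/-- `N(U, ε)`: the classes `h` with `λ {x | h x ∉ U} < ε`. -/
def basicNhd (U : Set G) (ε : ℝ≥0∞) : Set (LZero G) :=
  {h | ∃ f : lusinMaps G, mk f = h ∧ volume {x : I | f.1 x ∉ U} < ε}

/-- Membership in `N(U, ε)` does not depend on the representative. -/
theorem mk_mem_basicNhd {U : Set G} {ε : ℝ≥0∞} {f : lusinMaps G} :
    mk f ∈ basicNhd U ε ↔ volume {x : I | f.1 x ∉ U} < ε := by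
  refine ⟨?_, fun h => ⟨f, rfl, h⟩⟩
  rintro ⟨g, hg, h⟩
  rw [mk_eq_mk] at hg
  refine lt_of_le_of_lt (measure_mono_ae ?_) h
  filter_upwards [hg] with x hx hxU
  change g.1 x ∉ U
  rw [hx]
  exact hxU

variable (G)

/-- The sets `N(U, ε)`, for open neighbourhoods `U` of `1` and `ε > 0`, form a neighbourhood basis
of the neutral element for a group topology on `L⁰(G)`. -/
@[reducible]
def filterBasis : GroupFilterBasis (LZero G) where
  sets := {N | ∃ (U : Set G) (ε : ℝ≥0∞), IsOpen U ∧ (1 : G) ∈ U ∧ 0 < ε ∧ N = basicNhd U ε}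
  nonempty := ⟨_, univ, 1, isOpen_univ, mem_univ _, one_pos, rfl⟩
  inter_sets := by
    rintro _ _ ⟨U, ε, hU, hU1, hε, rfl⟩ ⟨V, δ, hV, hV1, hδ, rfl⟩
    refine ⟨_, ⟨U ∩ V, min ε δ, hU.inter hV, ⟨hU1, hV1⟩, lt_min hε hδ, rfl⟩, ?_⟩
    rintro _ ⟨f, rfl, hf⟩
    refine ⟨⟨f, rfl, ?_⟩, ⟨f, rfl, ?_⟩⟩
    · refine (measure_mono ?_).trans_lt (hf.trans_le (min_le_left _ _))
      exact fun x (hx : f.1 x ∉ U) (h : f.1 x ∈ U ∩ V) => hx h.1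
    · refine (measure_mono ?_).trans_lt (hf.trans_le (min_le_right _ _))
      exact fun x (hx : f.1 x ∉ V) (h : f.1 x ∈ U ∩ V) => hx h.2
  one' := by
    rintro _ ⟨U, ε, hU, hU1, hε, rfl⟩
    refine ⟨1, map_one _, ?_⟩
    simpa [hU1] using hε
  mul' := by
    rintro _ ⟨U, ε, hU, hU1, hε, rfl⟩
    obtain ⟨V, hV, hV1, hVU⟩ := exists_open_nhds_one_mul_subset (hU.mem_nhds hU1)
    refine ⟨_, ⟨V, ε / 2, hV, hV1, ENNReal.half_pos hε.ne', rfl⟩, ?_⟩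
    rintro _ ⟨_, ⟨f, rfl, hf⟩, _, ⟨g, rfl, hg⟩, rfl⟩
    refine ⟨f * g, map_mul _ _ _, ?_⟩
    calc volume {x : I | (f * g).1 x ∉ U}
        ≤ volume ({x : I | f.1 x ∉ V} ∪ {x : I | g.1 x ∉ V}) := by
          refine measure_mono fun x hx => ?_
          by_contra h
          simp only [mem_union, mem_ofPred_eq, not_or, not_not] at h
          exact hx (hVU (mul_mem_mul h.1 h.2))
      _ ≤ _ := measure_union_le _ _
      _ < ε / 2 + ε / 2 := ENNReal.add_lt_add hf hg
      _ = ε := ENNReal.add_halves ε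
  inv' := by
    rintro _ ⟨U, ε, hU, hU1, hε, rfl⟩
    refine ⟨_, ⟨U⁻¹, ε, hU.inv, by simpa using hU1, hε, rfl⟩, ?_⟩
    rintro _ ⟨f, rfl, hf⟩
    refine ⟨f⁻¹, map_inv _ _, ?_⟩
    simpa using hf
  conj' := by
    rintro h _ ⟨U, ε, hU, hU1, hε, rfl⟩
    obtain ⟨g, rfl⟩ := mk_surjective h
    obtain ⟨C, hC, hCε, hgC⟩ := g.2 (ε / 2) (ENNReal.half_pos hε.ne')
    -- By compactness of `C`, one neighbourhood of `1` works for all `x ∈ C`.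
    have key : ∀ᶠ z in 𝓝 (1 : G), ∀ x ∈ C, g.1 x * z * (g.1 x)⁻¹ ∈ U := by
      refine hC.isCompact.induction_on (p := fun S => ∀ᶠ z in 𝓝 (1 : G),
        ∀ x ∈ S, g.1 x * z * (g.1 x)⁻¹ ∈ U) ?_ ?_ ?_ ?_
      · simp
      · intro s t hst ht
        exact ht.mono fun z hz x hx => hz x (hst hx)
      · intro s t hs ht
        filter_upwards [hs, ht] with z h1 h2 x hx
        exact hx.elim (h1 x) (h2 x)
      · intro x hx
        have h1 : Tendsto (fun p : G × I => g.1 p.2 * p.1 * (g.1 p.2)⁻¹) (𝓝 1 ×ˢ 𝓝[C] x)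
            (𝓝 (g.1 x * 1 * (g.1 x)⁻¹)) := by
          have h2 : Tendsto (fun p : G × I => g.1 p.2) (𝓝 1 ×ˢ 𝓝[C] x) (𝓝 (g.1 x)) :=
            (hgC x hx).tendsto.comp tendsto_snd
          exact (h2.mul tendsto_fst).mul h2.inv
        have h3 := h1.eventually (hU.mem_nhds (by simpa using hU1))
        obtain ⟨pa, ha, pb, hb, hab⟩ := eventually_prod_iff.1 h3
        exact ⟨{y | pb y}, hb, ha.mono fun z hz y hy => hab hz hy⟩
    obtain ⟨V, hV, hVo, hV1⟩ := eventually_nhds_iff.1 key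
    refine ⟨_, ⟨V, ε / 2, hVo, hV1, ENNReal.half_pos hε.ne', rfl⟩, ?_⟩
    rintro _ ⟨f, rfl, hf⟩
    refine ⟨g * f * g⁻¹, by simp, ?_⟩
    by_cases hεt : ε = ⊤
    · rw [hεt]
      exact measure_lt_top _ _
    calc volume {x : I | (g * f * g⁻¹).1 x ∉ U}
        ≤ volume ({x : I | f.1 x ∉ V} ∪ Cᶜ) := by
          refine measure_mono fun x hx => ?_
          by_contra h
          simp only [mem_union, mem_ofPred_eq, mem_compl_iff, not_or, not_not] at h
          exact hx (hV _ h.1 x h.2)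
      _ ≤ _ := measure_union_le _ _
      _ < ε / 2 + ε / 2 :=
          ENNReal.add_lt_add_of_lt_of_le (ne_top_of_le_ne_top (by finiteness) hCε) hf hCε
      _ = ε := ENNReal.add_halves ε

/-- The topology of convergence in measure. -/
instance : TopologicalSpace (LZero G) := (filterBasis G).topology

instance : IsTopologicalGroup (LZero G) := (filterBasis G).isTopologicalGroup

end LZero

end LZero

/-! The implications run 1 → 4 → 3 → 2 → 1, and the substance is in 1 → 4. A tuple in `Gⁿ⁺¹` defines
a step map on `n + 1` equal intervals, and fine step maps approximate every element of `L⁰(G)`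
(`eventually_exists_stepHom`). An invariant mean on `G` iterates to an invariant mean on `Gⁿ⁺¹`
(`Mean.pow_invariant`); a limit of these along an ultrafilter makes `L⁰(G)` amenable.

For the measures, let `μ` be invariant on `X`, let `φ` be continuous, and regard `h ↦ φ(h • ·)` as a
map into `L²(μ)`. Changing few coordinates of a tuple changes its step map only on a small set,
whatever the new values are. Hence on step maps the orbit map is, up to a small uniform error,
Lipschitz for the Hamming distance with constant of order `1/n`. The Efron–Stein inequality
`Mean.pow_norm_sub_weak_sq_le` bounds its variance by order `1/n`, so it is nearly constant in mean.
Invariance of the mean and of `μ` turns this into `φ(h • ·) = φ` almost everywhere, for each `h`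
(`orbitLp_eq`), and regularity of `μ` gives the claim on fixed points.

The rest is soft: an amenable group has an invariant probability measure on each nonempty compact
space (4 → 3), a fixed point in the compact space of means is an invariant mean (3 → 2), and
functions on `G` are integrated along maps `[0,1] → G` (2 → 1). -/

/-! ### Right uniform continuity and extension of means -/

section RightUniform

variable {G : Type u} [Group G] [TopologicalSpace G]

/-- Bounded functions that vary little under left translation by elements close to `1`. -/
def IsRUC (f : G → ℝ) : Prop :=
  (∃ C : ℝ, ∀ x, |f x| ≤ C) ∧ ∀ ε > 0, ∀ᶠ u in 𝓝 (1 : G), ∀ x, |f (u * x) - f x| ≤ ε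

theorem mem_RUCb_iff [IsTopologicalGroup G] {f : G → ℝ} : f ∈ RUCb G ↔ IsRUC f := by
  refine and_congr_right fun _ => ?_
  let := IsTopologicalGroup.rightUniformSpace G
  have hu : uniformity G = comap (fun p : G × G => p.2 * p.1⁻¹) (𝓝 1) := rfl
  constructor
  · intro h ε hε
    have h1 := h (Metric.dist_mem_uniformity hε)
    rw [hu] at h1
    obtain ⟨t, ht, hts⟩ := mem_comap.1 h1
    filter_upwards [ht] with u hu x
    have := @hts (x, u * x) (by simpa using hu)
    rw [abs_sub_comm]
    exact le_of_lt this
  · intro h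
    rw [UniformContinuous, Metric.uniformity_basis_dist_le.tendsto_right_iff, hu]
    intro ε hε
    refine ((h ε hε).comap _).mono fun p hp => ?_
    have := hp p.1
    rw [inv_mul_cancel_right, abs_sub_comm] at this
    exact this

end RightUniform

/-- A mean on `S`: a linear functional on all real functions that is normalized, and positive on
bounded functions. -/
structure Mean (S : Type*) where
  lin : (S → ℝ) →ₗ[ℝ] ℝ
  nonneg : ∀ f : S → ℝ, (∃ C : ℝ, ∀ x, |f x| ≤ C) → (∀ x, 0 ≤ f x) → 0 ≤ lin f
  map_one : lin (fun _ => 1) = 1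

namespace Mean

variable {S : Type*} (m : Mean S)

theorem map_const (c : ℝ) : m.lin (fun _ => c) = c := by
  have : (fun _ : S => c) = c • fun _ => (1 : ℝ) := by ext; simp
  rw [this, map_smul, m.map_one, smul_eq_mul, mul_one]

theorem mono {f g : S → ℝ} (hf : ∃ C : ℝ, ∀ x, |f x| ≤ C) (hg : ∃ C : ℝ, ∀ x, |g x| ≤ C)
    (h : ∀ x, f x ≤ g x) : m.lin f ≤ m.lin g := by
  obtain ⟨C, hC⟩ := hf
  obtain ⟨D, hD⟩ := hg
  have := m.nonneg (g - f) ⟨D + C, fun x => (abs_sub _ _).trans (add_le_add (hD x) (hC x))⟩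
    fun x => sub_nonneg.2 (h x)
  rw [map_sub] at this
  linarith

theorem abs_le {f : S → ℝ} {C : ℝ} (h : ∀ x, |f x| ≤ C) : |m.lin f| ≤ C := by
  have hc (c : ℝ) : ∃ C : ℝ, ∀ _ : S, |c| ≤ C := ⟨|c|, fun _ => le_rfl⟩
  refine _root_.abs_le.2 ⟨?_, ?_⟩
  · rw [← m.map_const (-C)]
    exact m.mono (hc _) ⟨C, h⟩ fun x => neg_le_of_abs_le (h x)
  · rw [← m.map_const C]
    exact m.mono ⟨C, h⟩ (hc _) fun x => le_of_abs_le (h x)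

theorem abs_sub_le {f g : S → ℝ} {ε : ℝ} (h : ∀ x, |f x - g x| ≤ ε) :
    |m.lin f - m.lin g| ≤ ε := by
  rw [← map_sub]
  exact m.abs_le h

end Mean

/-- An invariant mean on `RUC_b(G)` extends to a mean on all functions. -/
theorem IsAmenableGroup.exists_mean {G : Type u} [Group G] [TopologicalSpace G]
    [IsTopologicalGroup G] (h : IsAmenableGroup G) :
    ∃ m : Mean G, ∀ (g : G) (f : G → ℝ), IsRUC f → m.lin (fun x => f (g * x)) = m.lin f := by
  obtain ⟨m, hpos, hone, hinv⟩ := h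
  let B : Submodule ℝ (G → ℝ) :=
    { carrier := {f | ∃ C : ℝ, ∀ x, |f x| ≤ C}
      zero_mem' := ⟨0, by simp⟩
      add_mem' := by
        rintro f g ⟨C, hC⟩ ⟨D, hD⟩
        exact ⟨C + D, fun x => (abs_add_le _ _).trans (add_le_add (hC x) (hD x))⟩
      smul_mem' := by
        rintro c f ⟨C, hC⟩
        refine ⟨|c| * C, fun x => ?_⟩
        simpa [abs_mul] using mul_le_mul_of_nonneg_left (hC x) (abs_nonneg c) }
  let p : B →ₗ.[ℝ] ℝ :=
    { domain := (RUCb G).comap B.subtype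
      toFun := m ∘ₗ ((B.subtype ∘ₗ ((RUCb G).comap B.subtype).subtype).codRestrict (RUCb G)
        fun x => x.2) }
  let s : PointedCone ℝ B :=
    { carrier := {f | ∀ x, 0 ≤ f.1 x}
      zero_mem' := fun x => le_rfl
      add_mem' := fun hf hg x => add_nonneg (hf x) (hg x)
      smul_mem' := fun c f hf x => mul_nonneg c.2 (hf x) }
  -- Cofinality: constants lie in `RUCb G`, and adding a large one makes any bounded function
  -- nonnegative.
  obtain ⟨q, hq, hq'⟩ := riesz_extension s p (fun x hx => hpos _ hx) fun y => by
    obtain ⟨C, hC⟩ := y.2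
    have h1 : C • (RUCb.one (G := G)).1 ∈ RUCb G := (C • (RUCb.one (G := G))).2
    refine ⟨⟨⟨C • (RUCb.one (G := G)).1, h1.1⟩, h1⟩, fun x => ?_⟩
    have := neg_le_of_abs_le (hC x)
    change 0 ≤ C * 1 + y.1 x
    linarith
  -- This second extension is purely algebraic, so positivity survives only on bounded functions. It
  -- frees later arguments from membership proofs.
  obtain ⟨r, hr⟩ := LinearMap.exists_extend q
  have hr' (f : G → ℝ) (hf : f ∈ B) : r f = q ⟨f, hf⟩ := congr($hr ⟨f, hf⟩)
  have hrm (f : RUCb G) : r f.1 = m f := by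
    rw [hr' f.1 f.2.1]
    exact hq ⟨⟨f.1, f.2.1⟩, f.2⟩
  refine ⟨⟨r, fun f hf hf' => ?_, ?_⟩, fun g f hf => ?_⟩
  · rw [hr' f hf]
    exact hq' _ hf'
  · exact (hrm RUCb.one).trans hone
  · have hf' := mem_RUCb_iff.2 hf
    exact (hrm (RUCb.translate g ⟨f, hf'⟩)).trans ((hinv g _).trans (hrm ⟨f, hf'⟩).symm)

/-! ### Iterated means on powers -/

namespace Mean

variable {G : Type u}

/-- The iterated mean `m ⊗ ⋯ ⊗ m` on `Gⁿ`. -/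
noncomputable def pow (m : Mean G) : (n : ℕ) → Mean (Fin n → G)
  | 0 =>
    { lin := LinearMap.proj Fin.elim0
      nonneg := fun _ _ h => h _
      map_one := rfl }
  | n + 1 =>
    { lin := m.lin ∘ₗ LinearMap.pi fun t =>
        (m.pow n).lin ∘ₗ LinearMap.funLeft ℝ ℝ fun s : Fin n → G => (Fin.cons t s : Fin (n + 1) → G)
      nonneg := by
        rintro f ⟨C, hC⟩ hf
        refine m.nonneg _ ⟨C, fun t => (m.pow n).abs_le fun s => hC _⟩ fun t => ?_
        exact (m.pow n).nonneg _ ⟨C, fun s => hC _⟩ fun s => hf _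
      map_one := by
        refine Eq.trans (congrArg m.lin (funext fun t => ?_)) m.map_one
        exact (m.pow n).map_one }

theorem pow_succ_apply (m : Mean G) (n : ℕ) (f : (Fin (n + 1) → G) → ℝ) :
    (m.pow (n + 1)).lin f = m.lin fun t => (m.pow n).lin fun s => f (Fin.cons t s) :=
  rfl

/-- The inner mean absorbs the translation of the tail, the outer one that of the first coordinate.
The outer step applies because means are contractive for the sup norm, so the inner mean is still an
`IsRUC` function of the first coordinate. -/
theorem pow_invariant [Group G] [TopologicalSpace G] (m : Mean G)
    (hm : ∀ (g : G) (f : G → ℝ), IsRUC f → m.lin (fun x => f (g * x)) = m.lin f) (n : ℕ) :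
    ∀ (g : Fin n → G) (f : (Fin n → G) → ℝ), IsRUC f →
      (m.pow n).lin (fun x => f (g * x)) = (m.pow n).lin f := by
  induction n with
  | zero =>
    intro g f _
    exact congrArg _ (funext fun x => congrArg f (Subsingleton.elim _ _))
  | succ n ih =>
    intro g f hf
    obtain ⟨⟨C, hC⟩, hf⟩ := hf
    have hmul (a b : G) (s t : Fin n → G) :
        (Fin.cons (a * b) (s * t) : Fin (n + 1) → G) = Fin.cons a s * Fin.cons b t := by
      ext i
      refine Fin.cases ?_ (fun i => ?_) i <;> simp
    have hone : (Fin.cons 1 1 : Fin (n + 1) → G) = 1 := by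
      ext i
      refine Fin.cases ?_ (fun i => ?_) i <;> simp
    have h1 : Tendsto (fun u : G => (Fin.cons u 1 : Fin (n + 1) → G)) (𝓝 1) (𝓝 1) := by
      have : Continuous fun u : G => (Fin.cons u 1 : Fin (n + 1) → G) :=
        Continuous.finCons (A := fun _ => G) continuous_id continuous_const
      simpa only [hone] using this.tendsto 1
    have h2 : Tendsto (fun u : Fin n → G => (Fin.cons 1 u : Fin (n + 1) → G)) (𝓝 1) (𝓝 1) := by
      have : Continuous fun u : Fin n → G => (Fin.cons 1 u : Fin (n + 1) → G) :=
        Continuous.finCons (A := fun _ => G) continuous_const continuous_id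
      simpa only [hone] using this.tendsto 1
    have hslice (t : G) : IsRUC fun s : Fin n → G => f (Fin.cons t s) := by
      refine ⟨⟨C, fun s => hC _⟩, fun ε hε => (h2.eventually (hf ε hε)).mono fun u hu s => ?_⟩
      simpa [← hmul] using hu (Fin.cons t s)
    have hmean : IsRUC fun t : G => (m.pow n).lin fun s => f (Fin.cons t s) := by
      refine ⟨⟨C, fun t => (m.pow n).abs_le fun s => hC _⟩,
        fun ε hε => (h1.eventually (hf ε hε)).mono fun u hu t => ?_⟩
      refine (m.pow n).abs_sub_le fun s => ?_
      simpa [← hmul] using hu (Fin.cons t s)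
    rw [pow_succ_apply, pow_succ_apply, ← hm (g 0) _ hmean]
    congr 1
    ext t
    rw [← ih (Fin.tail g) _ (hslice (g 0 * t))]
    congr 1
    ext s
    rw [hmul, Fin.cons_self_tail]

end Mean

/-! ### Weak means in Hilbert spaces and the Efron–Stein inequality -/

namespace Mean

variable {S : Type*} {E : Type*} [NormedAddCommGroup E] [InnerProductSpace ℝ E] [CompleteSpace E]

/-- The weak mean of a bounded function with values in a Hilbert space. -/
theorem exists_weak (m : Mean S) {W : S → E} {C : ℝ} (hW : ∀ s, ‖W s‖ ≤ C) :
    ∃ v : E, ∀ w, inner ℝ v w = m.lin fun s => inner ℝ (W s) w := by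
  let L : E →ₗ[ℝ] ℝ := m.lin ∘ₗ LinearMap.pi fun s => innerₛₗ ℝ (W s)
  have hL (w : E) : ‖L w‖ ≤ C * ‖w‖ := m.abs_le fun s =>
    (abs_real_inner_le_norm _ _).trans (by gcongr; exact hW s)
  refine ⟨(InnerProductSpace.toDual ℝ E).symm (L.mkContinuous C hL), fun w => ?_⟩
  rw [InnerProductSpace.toDual_symm_apply]
  rfl

/-- The weak mean of a bounded function with values in a Hilbert space, `0` for other functions. -/
noncomputable def weak (m : Mean S) (W : S → E) : E :=
  open Classical in if h : ∃ C, ∀ s, ‖W s‖ ≤ C then (m.exists_weak h.choose_spec).choose else 0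

theorem inner_weak (m : Mean S) {W : S → E} {C : ℝ} (hW : ∀ s, ‖W s‖ ≤ C) (w : E) :
    inner ℝ (m.weak W) w = m.lin fun s => inner ℝ (W s) w := by
  have h : ∃ C, ∀ s, ‖W s‖ ≤ C := ⟨C, hW⟩
  rw [weak, dif_pos h]
  exact (m.exists_weak h.choose_spec).choose_spec w

theorem norm_weak_sub_weak_le (m : Mean S) {W W' : S → E} {C D c : ℝ} (hW : ∀ s, ‖W s‖ ≤ C)
    (hW' : ∀ s, ‖W' s‖ ≤ D) (hc : 0 ≤ c) (h : ∀ s, ‖W s - W' s‖ ≤ c) :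
    ‖m.weak W - m.weak W'‖ ≤ c := by
  set v := m.weak W - m.weak W' with hv
  have h1 : ‖v‖ * ‖v‖ ≤ c * ‖v‖ := by
    rw [← real_inner_self_eq_norm_mul_norm]
    nth_rw 1 [hv]
    rw [inner_sub_left, m.inner_weak hW, m.inner_weak hW', ← map_sub]
    refine (le_abs_self _).trans (m.abs_le fun s => ?_)
    rw [Pi.sub_apply, ← inner_sub_left]
    exact (abs_real_inner_le_norm _ _).trans (by gcongr; exact h s)
  by_contra! hlt
  exact absurd (le_of_mul_le_mul_right h1 (hc.trans_lt hlt)) (not_le.2 hlt)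

/-- The mean square distance to a point splits off the distance to the weak mean. -/
theorem norm_sub_sq_eq (m : Mean S) {W : S → E} {C : ℝ} (hW : ∀ s, ‖W s‖ ≤ C) (v : E) :
    m.lin (fun s => ‖W s - v‖ ^ 2) =
      m.lin (fun s => ‖W s - m.weak W‖ ^ 2) + ‖m.weak W - v‖ ^ 2 := by
  set a := m.weak W with ha
  -- The cross term `2⟨W s - a, a - v⟩` has mean zero by the choice of `a`.
  have h1 : (fun s => ‖W s - v‖ ^ 2) = (fun s => ‖W s - a‖ ^ 2) +
      ((2 : ℝ) • ((fun s => inner ℝ (W s) (a - v)) - fun _ => inner ℝ a (a - v)) +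
        fun _ => ‖a - v‖ ^ 2) := by
    ext s
    have : W s - v = (W s - a) + (a - v) := by abel
    rw [this, norm_add_sq_real]
    simp only [Pi.add_apply, Pi.smul_apply, Pi.sub_apply, smul_eq_mul, ← inner_sub_left]
    ring
  rw [h1, map_add, map_add, map_smul, map_sub, m.map_const, m.map_const, ← m.inner_weak hW, ← ha,
    sub_self, smul_zero, zero_add]

variable {G : Type u} [DecidableEq G]

/-- The Efron–Stein inequality for Hilbert space valued functions on a power, which are
Lipschitz for the Hamming distance. -/
theorem pow_norm_sub_weak_sq_le (m : Mean G) {c : ℝ} (hc : 0 ≤ c) (n : ℕ) :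
    ∀ (W : (Fin n → G) → E) (C : ℝ), (∀ k, ‖W k‖ ≤ C) →
      (∀ k l, ‖W k - W l‖ ≤ c * hammingDist k l) →
      (m.pow n).lin (fun k => ‖W k - (m.pow n).weak W‖ ^ 2) ≤ n * c ^ 2 := by
  induction n with
  | zero =>
    intro W C hW _
    have h := (m.pow 0).norm_sub_sq_eq hW (W Fin.elim0)
    have h2 : (m.pow 0).lin (fun k => ‖W k - W Fin.elim0‖ ^ 2) = 0 := by
      change ‖W Fin.elim0 - W Fin.elim0‖ ^ 2 = 0
      simp
    rw [h2] at h
    simp only [Nat.cast_zero, zero_mul]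
    nlinarith [sq_nonneg ‖(m.pow 0).weak W - W Fin.elim0‖]
  | succ n ih =>
    intro W C hW hL
    have hsq (k : Fin (n + 1) → G) (v : E) : |‖W k - v‖ ^ 2| ≤ (C + ‖v‖) ^ 2 := by
      rw [abs_of_nonneg (sq_nonneg _)]
      gcongr
      exact (norm_sub_le _ _).trans (by gcongr; exact hW k)
    have hcons (t : G) (s s' : Fin n → G) :
        hammingDist (Fin.cons t s : Fin (n + 1) → G) (Fin.cons t s') = hammingDist s s' := by
      simp [hammingDist, Fin.univ_succ, Finset.filter_insert]
      rw [Finset.filter_map, Finset.card_map]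
      rfl
    have hcons' (t t' : G) (s : Fin n → G) :
        hammingDist (Fin.cons t s : Fin (n + 1) → G) (Fin.cons t' s) ≤ 1 := by
      refine (Finset.card_le_card (t := {0}) fun i hi => ?_).trans_eq (Finset.card_singleton _)
      revert hi
      refine Fin.cases ?_ (fun i => ?_) i <;> simp
    let A (t : G) : E := (m.pow n).weak fun s => W (Fin.cons t s)
    by_cases hG : Nonempty G
    swap
    · have h : (fun _ : G => (1 : ℝ)) = 0 := funext fun x => (hG ⟨x⟩).elim
      have := m.map_one
      rw [h, map_zero] at this
      exact absurd this zero_ne_one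
    obtain ⟨t₀⟩ := hG
    -- The weak mean minimizes the mean square distance, so any centre gives an upper bound. With
    -- centre `A t₀`, each slice contributes its own variance, at most `n * c ^ 2`, plus `‖A t - A
    -- t₀‖ ^ 2 ≤ c ^ 2`.
    have h1 := (m.pow (n + 1)).norm_sub_sq_eq hW (A t₀)
    have h2 : (m.pow (n + 1)).lin (fun k => ‖W k - A t₀‖ ^ 2) ≤ n * c ^ 2 + c ^ 2 := by
      rw [pow_succ_apply]
      refine (le_abs_self _).trans (m.abs_le fun t => ?_)
      rw [(m.pow n).norm_sub_sq_eq (fun s => hW _) (A t₀)]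
      have hA : ‖A t - A t₀‖ ≤ c := by
        refine (m.pow n).norm_weak_sub_weak_le (fun s => hW _) (fun s => hW _) hc fun s => ?_
        refine (hL _ _).trans (mul_le_of_le_one_right hc ?_)
        exact_mod_cast hcons' t t₀ s
      have h3 := ih (fun s => W (Fin.cons t s)) C (fun s => hW _) fun s s' => by
        simpa only [hcons] using hL (Fin.cons t s) (Fin.cons t s')
      have h4 := (m.pow n).nonneg (fun s => ‖W (Fin.cons t s) - A t‖ ^ 2) ⟨_, fun s => hsq _ _⟩
        fun s => sq_nonneg _
      rw [abs_of_nonneg (add_nonneg h4 (sq_nonneg _))]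
      gcongr
    push_cast
    nlinarith [sq_nonneg ‖(m.pow (n + 1)).weak W - A t₀‖]

end Mean

/-! ### Subdivisions of the interval and step maps -/

/-- The index of the subinterval of length `1 / (n + 1)` that contains a given point. -/
noncomputable def blockIndex (n : ℕ) (x : I) : Fin (n + 1) :=
  -- The minimum puts the endpoint `x = 1` into the last block.
  ⟨min ⌊((n : ℝ) + 1) * x⌋₊ n, Nat.lt_succ_of_le (min_le_right _ _)⟩

theorem measurable_blockIndex (n : ℕ) : Measurable (blockIndex n) := by
  have h : Measurable fun x : I => min ⌊((n : ℝ) + 1) * x⌋₊ n :=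
    (Nat.measurable_floor.comp (measurable_subtype_coe.const_mul _)).min measurable_const
  refine measurable_to_countable' fun i => ?_
  convert h (measurableSet_singleton i.1) using 1
  ext x
  exact Fin.ext_iff

theorem mul_mem_Icc_blockIndex (n : ℕ) (x : I) :
    ((n : ℝ) + 1) * x ∈ Icc (blockIndex n x : ℝ) (blockIndex n x + 1) := by
  have h0 : 0 ≤ ((n : ℝ) + 1) * x := mul_nonneg (by positivity) x.2.1
  have h1 : (blockIndex n x : ℝ) = min (⌊((n : ℝ) + 1) * x⌋₊ : ℝ) n := by
    simp [blockIndex]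
  rw [h1]
  refine ⟨(min_le_left _ _).trans (Nat.floor_le h0), ?_⟩
  rw [← min_add_add_right]
  exact le_min (Nat.lt_floor_add_one _).le (mul_le_of_le_one_right (by positivity) x.2.2)

theorem abs_sub_le_of_blockIndex_eq {n : ℕ} {x y : I} (h : blockIndex n x = blockIndex n y) :
    |(x : ℝ) - y| ≤ 1 / (n + 1) := by
  have hx := mul_mem_Icc_blockIndex n x
  have hy := mul_mem_Icc_blockIndex n y
  rw [h] at hx
  have hn : 0 < (n : ℝ) + 1 := by positivity
  have h1 : |(x : ℝ) - y| * (n + 1) = |(x - y) * ((n : ℝ) + 1)| := by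
    rw [abs_mul, abs_of_pos hn]
  rw [le_div_iff₀ hn, h1, abs_le]
  constructor <;> nlinarith [hx.1, hx.2, hy.1, hy.2]

theorem volume_blockIndex_eq_le (n : ℕ) (i : Fin (n + 1)) :
    volume {x : I | blockIndex n x = i} ≤ ENNReal.ofReal (1 / (n + 1)) := by
  have hn : 0 < (n : ℝ) + 1 := by positivity
  have hi : (i : ℝ) + 1 ≤ n + 1 := by exact_mod_cast i.2
  let a : I := ⟨i / (n + 1), by positivity, by rw [div_le_one hn]; linarith⟩
  let b : I := ⟨(i + 1) / (n + 1), by positivity, by rw [div_le_one hn]; linarith⟩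
  refine (measure_mono (t := Icc a b) ?_).trans_eq ?_
  · rintro x rfl
    have := mul_mem_Icc_blockIndex n x
    refine ⟨Subtype.coe_le_coe.1 ?_, Subtype.coe_le_coe.1 ?_⟩
    · rw [div_le_iff₀ hn, mul_comm]
      exact this.1
    · rw [le_div_iff₀ hn, mul_comm]
      exact this.2
  · rw [unitInterval.volume_Icc]
    congr 1
    change ((i : ℝ) + 1) / (n + 1) - i / (n + 1) = _
    ring

theorem volume_blockIndex_mem_le (n : ℕ) (s : Finset (Fin (n + 1))) :
    volume {x : I | blockIndex n x ∈ s} ≤ ENNReal.ofReal (s.card / (n + 1)) := by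
  have h : {x : I | blockIndex n x ∈ s} = ⋃ i ∈ s, {x : I | blockIndex n x = i} := by
    ext; simp
  rw [h]
  refine (measure_biUnion_finset_le _ _).trans
    ((Finset.sum_le_sum fun i _ => volume_blockIndex_eq_le n i).trans_eq ?_)
  rw [Finset.sum_const, nsmul_eq_mul, ← ENNReal.ofReal_natCast,
    ← ENNReal.ofReal_mul (by positivity)]
  congr 1
  ring

/-- A measurable map to a finite discrete space followed by any map is strongly measurable. -/
theorem lusinMeasurable_comp_of_finite {X ι Y : Type*} [TopologicalSpace X] [MeasurableSpace X]
    [BorelSpace X] [Finite ι] [MeasurableSpace ι] [MeasurableSingletonClass ι] [TopologicalSpace Y]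
    (μ : Measure X) [IsFiniteMeasure μ] [μ.InnerRegularCompactLTTop] [T2Space X]
    {p : X → ι} (hp : Measurable p) (g : ι → Y) : LusinMeasurable μ (g ∘ p) := by
  intro ε hε
  have := Fintype.ofFinite ι
  obtain ⟨δ, hδ, hδε⟩ := ENNReal.exists_pos_sum_of_countable' hε.ne' ι
  have h (i : ι) : ∃ K ⊆ p ⁻¹' {i}, IsCompact K ∧ μ (p ⁻¹' {i} \ K) < δ i :=
    (hp (measurableSet_singleton i)).exists_isCompact_sdiff_lt (measure_ne_top _ _) (hδ i).ne'
  choose K hKp hK hKδ using h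
  have hcl (i : ι) : IsClosed (K i) := (hK i).isClosed
  refine ⟨⋃ i, K i, isClosed_iUnion_of_finite hcl, ?_, ?_⟩
  · have hsub : (⋃ i, K i)ᶜ ⊆ ⋃ i, p ⁻¹' {i} \ K i := by
      intro x hx
      rw [mem_compl_iff, mem_iUnion, not_exists] at hx
      exact mem_iUnion.2 ⟨p x, rfl, hx _⟩
    refine (measure_mono hsub).trans ((measure_iUnion_le _).trans (le_trans ?_ hδε.le))
    exact ENNReal.tsum_le_tsum fun i => (hKδ i).le
  · refine (locallyFinite_of_finite _).continuousOn_iUnion hcl fun i => ?_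
    refine (continuousOn_const (c := g i)).congr fun x hx => ?_
    exact congrArg g (hKp i hx)

section Step

variable {G : Type u} [Group G] [TopologicalSpace G] [IsTopologicalGroup G]

/-- The homomorphism from `Gⁿ⁺¹` to `L⁰(G)` that sends a tuple to the corresponding step map. -/
noncomputable def stepHom (G : Type u) [Group G] [TopologicalSpace G] [IsTopologicalGroup G]
    (n : ℕ) : (Fin (n + 1) → G) →* LZero G :=
  LZero.mk.comp
    { toFun := fun k => ⟨k ∘ blockIndex n,
        lusinMeasurable_comp_of_finite volume (measurable_blockIndex n) k⟩
      map_one' := rfl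
      map_mul' := fun _ _ => rfl }

theorem LZero.hasBasis_nhds_one : (𝓝 (1 : LZero G)).HasBasis
    (fun p : Set G × ℝ≥0∞ => IsOpen p.1 ∧ (1 : G) ∈ p.1 ∧ 0 < p.2)
    fun p => LZero.basicNhd p.1 p.2 := by
  refine ⟨fun t => ?_⟩
  rw [(LZero.filterBasis G).nhds_one_hasBasis.mem_iff]
  constructor
  · rintro ⟨_, ⟨U, ε, h1, h2, h3, rfl⟩, ht⟩
    exact ⟨(U, ε), ⟨h1, h2, h3⟩, ht⟩
  · rintro ⟨⟨U, ε⟩, ⟨h1, h2, h3⟩, ht⟩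
    exact ⟨_, ⟨U, ε, h1, h2, h3, rfl⟩, ht⟩

theorem tendsto_stepHom (n : ℕ) : Tendsto (stepHom G n) (𝓝 1) (𝓝 1) := by
  rw [LZero.hasBasis_nhds_one.tendsto_right_iff]
  rintro ⟨U, ε⟩ ⟨hU, hU1, hε⟩
  have h : (univ : Set (Fin (n + 1))).pi (fun _ => U) ∈ 𝓝 (1 : Fin (n + 1) → G) :=
    set_pi_mem_nhds finite_univ fun i _ => hU.mem_nhds hU1
  filter_upwards [h] with k hk
  refine LZero.mk_mem_basicNhd.2 ?_
  have : {x : I | k (blockIndex n x) ∉ U} = ∅ := by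
    ext x
    simpa using hk _ (mem_univ _)
  exact (congrArg volume this).trans_lt (by simpa using hε)

/-- The quotient is `1` except on the blocks where the tuples differ, whose total length is at most
the normalized Hamming distance. No closeness of values in `G` is needed. -/
theorem stepHom_div_mem_basicNhd [DecidableEq G] {n : ℕ} {U : Set G} (hU : (1 : G) ∈ U) {η : ℝ}
    {k l : Fin (n + 1) → G} (h : (hammingDist k l : ℝ) / (n + 1) < η) :
    stepHom G n k * (stepHom G n l)⁻¹ ∈ LZero.basicNhd U (ENNReal.ofReal η) := by
  rw [← map_inv, ← map_mul]
  refine LZero.mk_mem_basicNhd.2 ?_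
  refine lt_of_le_of_lt ?_ ((ENNReal.ofReal_lt_ofReal_iff_of_nonneg (by positivity)).2 h)
  refine (measure_mono fun x hx => ?_).trans (volume_blockIndex_mem_le n _)
  rw [mem_ofPred_eq, Finset.mem_filter_univ]
  intro hkl
  refine hx ?_
  change k (blockIndex n x) * (l (blockIndex n x))⁻¹ ∈ U
  rwa [hkl, mul_inv_cancel]

/-- Every element of `L⁰(G)` is approximated by step maps over any sufficiently fine subdivision. -/
theorem eventually_exists_stepHom (h : LZero G) {N : Set (LZero G)} (hN : N ∈ 𝓝 1) :
    ∀ᶠ n in atTop, ∃ g, h * (stepHom G n g)⁻¹ ∈ N := by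
  obtain ⟨⟨U, ε⟩, ⟨hU, hU1, hε⟩, hUN⟩ := LZero.hasBasis_nhds_one.mem_iff.1 hN
  obtain ⟨f, rfl⟩ := LZero.mk_surjective h
  obtain ⟨δ, hδ, hδε⟩ := exists_between hε
  obtain ⟨A, hA, hAδ, hfA⟩ := f.2 δ hδ
  let := IsTopologicalGroup.rightUniformSpace G
  have hu : uniformity G = comap (fun p : G × G => p.2 * p.1⁻¹) (𝓝 1) := rfl
  have huc := hA.isCompact.uniformContinuousOn_of_continuous hfA
  have hent : {p : G × G | p.2 * p.1⁻¹ ∈ U} ∈ uniformity G := by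
    rw [hu]
    exact preimage_mem_comap (hU.mem_nhds hU1)
  obtain ⟨r, hr, hrU⟩ := Metric.mem_uniformity_dist.1 (mem_inf_principal.1 (huc hent))
  have hlim := (tendsto_one_div_add_atTop_nhds_zero_nat (𝕜 := ℝ)).eventually (gt_mem_nhds hr)
  filter_upwards [hlim] with n hn
  classical
  -- Sample `f` in each block at a point of `A`, where `f` is uniformly continuous. The default `1`
  -- is used only on blocks missing `A`.
  let g (i : Fin (n + 1)) : G :=
    if h : ∃ a ∈ A, blockIndex n a = i then f.1 h.choose else 1
  refine ⟨g, hUN ?_⟩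
  rw [← map_inv, stepHom, MonoidHom.comp_apply, ← map_mul]
  refine LZero.mk_mem_basicNhd.2 ((measure_mono fun x hx => ?_).trans_lt (hAδ.trans_lt hδε))
  intro hxA
  refine hx ?_
  have hex : ∃ a ∈ A, blockIndex n a = blockIndex n x := ⟨x, hxA, rfl⟩
  have hg : g (blockIndex n x) = f.1 hex.choose := dif_pos hex
  change f.1 x * (g (blockIndex n x))⁻¹ ∈ U
  rw [hg]
  refine @hrU hex.choose x ?_ ⟨hex.choose_spec.1, hxA⟩
  exact (abs_sub_le_of_blockIndex_eq hex.choose_spec.2).trans_lt hn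

end Step

/-! ### Amenability passes between `G` and `L⁰(G)` -/

section Amenable

variable {G : Type u} [Group G] [TopologicalSpace G] [IsTopologicalGroup G]

theorem isRUC_comp_stepHom {f : LZero G → ℝ} (hf : IsRUC f) (n : ℕ) :
    IsRUC fun k => f (stepHom G n k) := by
  obtain ⟨⟨C, hC⟩, hf⟩ := hf
  refine ⟨⟨C, fun k => hC _⟩, fun ε hε => ?_⟩
  filter_upwards [(tendsto_stepHom n).eventually (hf ε hε)] with u hu k
  rw [map_mul]
  exact hu _

/-- The group `L⁰(G)` inherits amenability from `G`: take a limit of iterated means along the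
subgroups of step maps. -/
theorem IsAmenableGroup.lZero (h : IsAmenableGroup G) : IsAmenableGroup (LZero G) := by
  obtain ⟨m, hm⟩ := h.exists_mean
  let a (f : RUCb (LZero G)) (n : ℕ) : ℝ := (m.pow (n + 1)).lin fun k => f.1 (stepHom G n k)
  have hlim (f : RUCb (LZero G)) : ∃ c, Tendsto (a f) (hyperfilter ℕ) (𝓝 c) := by
    obtain ⟨C, hC⟩ := f.2.1
    have h0 : ∀ᶠ n in (hyperfilter ℕ : Filter ℕ), a f n ∈ Icc (-C) C :=
      Eventually.of_forall fun n => abs_le.1 ((m.pow (n + 1)).abs_le fun k => hC _)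
    have h1 : ((hyperfilter ℕ).map (a f) : Filter ℝ) ≤ 𝓟 (Icc (-C) C) := le_principal_iff.2 h0
    obtain ⟨c, -, hc⟩ := (isCompact_Icc (a := -C) (b := C)).ultrafilter_le_nhds _ h1
    exact ⟨c, hc⟩
  choose c hc using hlim
  refine ⟨⟨⟨c, fun f g => ?_⟩, fun r f => ?_⟩, fun f hf => ?_, ?_, fun h f => ?_⟩
  · refine tendsto_nhds_unique (hc (f + g)) (((hc f).add (hc g)).congr fun n => ?_)
    exact (map_add (m.pow (n + 1)).lin _ _).symm
  · refine tendsto_nhds_unique (hc (r • f)) (((hc f).const_mul r).congr fun n => ?_)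
    exact (map_smul (m.pow (n + 1)).lin _ _).symm
  · refine ge_of_tendsto' (hc f) fun n => (m.pow (n + 1)).nonneg _ ?_ fun k => hf _
    exact ⟨f.2.1.choose, fun k => f.2.1.choose_spec _⟩
  · exact tendsto_nhds_unique (hc RUCb.one)
      (tendsto_const_nhds.congr fun n => (m.pow (n + 1)).map_one.symm)
  -- Replacing `h` by a nearby step map `g` costs at most `ε / 2` uniformly, and translation by `g`
  -- does not change the iterated mean.
  · have h1 : Tendsto (fun n => a (RUCb.translate h f) n - a f n) atTop (𝓝 0) := by
      have hf := mem_RUCb_iff.1 f.2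
      rw [Metric.tendsto_nhds]
      intro ε hε
      filter_upwards [eventually_exists_stepHom h (hf.2 (ε / 2) (half_pos hε))] with n hn
      obtain ⟨g, hg⟩ := hn
      rw [dist_zero_right, Real.norm_eq_abs]
      refine lt_of_le_of_lt ?_ (half_lt_self hε)
      have h2 := m.pow_invariant hm (n + 1) g _ (isRUC_comp_stepHom hf n)
      change |a (RUCb.translate h f) n - (m.pow (n + 1)).lin _| ≤ _
      rw [← h2]
      refine (m.pow (n + 1)).abs_sub_le fun k => ?_
      have := hg (stepHom G n g * stepHom G n k)
      rwa [← mul_assoc, inv_mul_cancel_right, ← map_mul] at this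
    refine sub_eq_zero.1 (tendsto_nhds_unique ((hc (RUCb.translate h f)).sub (hc f))
      (h1.mono_left ?_))
    rw [← Nat.cofinite_eq_atTop]
    exact hyperfilter_le_cofinite

/-- Strongly measurable real functions are almost everywhere strongly measurable. -/
theorem LusinMeasurable.aestronglyMeasurable {X : Type*} [TopologicalSpace X] [MeasurableSpace X]
    [BorelSpace X] {μ : Measure X} {f : X → ℝ} (hf : LusinMeasurable μ f) :
    AEStronglyMeasurable f μ := by
  have h (n : ℕ) : ∃ A : Set X, IsClosed A ∧ μ Aᶜ ≤ (n : ℝ≥0∞)⁻¹ ∧ ContinuousOn f A :=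
    hf _ (by simp)
  choose A hA hAμ hfA using h
  have hnull : μ (⋃ n, A n)ᶜ = 0 := by
    refine le_antisymm (ge_of_tendsto' ENNReal.tendsto_inv_nat_nhds_zero fun n => ?_) bot_le
    exact (measure_mono (compl_subset_compl.2 (subset_iUnion A n))).trans (hAμ n)
  rw [← Measure.restrict_eq_self_of_ae_mem (s := ⋃ n, A n) (μ := μ) hnull]
  exact aestronglyMeasurable_iUnion_iff.2 fun n =>
    (hfA n).aestronglyMeasurable (hA n).measurableSet

theorem LusinMeasurable.comp_continuous {X Y Z : Type*} [TopologicalSpace X] [MeasurableSpace X]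
    [TopologicalSpace Y] [TopologicalSpace Z] {μ : Measure X} {f : X → Y}
    (hf : LusinMeasurable μ f) {φ : Y → Z} (hφ : Continuous φ) : LusinMeasurable μ (φ ∘ f) := by
  intro ε hε
  obtain ⟨A, hA, hA', hfA⟩ := hf ε hε
  exact ⟨A, hA, hA', hφ.comp_continuousOn hfA⟩

theorem IsRUC.continuous {f : G → ℝ} (hf : IsRUC f) : Continuous f := by
  rw [continuous_iff_continuousAt]
  intro x
  rw [ContinuousAt, Metric.nhds_basis_closedBall.tendsto_right_iff]
  intro ε hε
  have h1 : Tendsto (fun y => y * x⁻¹) (𝓝 x) (𝓝 1) := by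
    have : Continuous fun y => y * x⁻¹ := by fun_prop
    simpa using this.tendsto x
  filter_upwards [h1.eventually (hf.2 ε hε)] with y hy
  simpa [Real.dist_eq] using hy x

/-- `G` inherits amenability from `L⁰(G)`: average functions on `G` along elements of `L⁰(G)`. -/
theorem IsAmenableGroup.of_lZero (h : IsAmenableGroup (LZero G)) : IsAmenableGroup G := by
  obtain ⟨m, hpos, hone, hinv⟩ := h
  have hrep (h : LZero G) : ∃ f : lusinMaps G, LZero.mk f = h := LZero.mk_surjective h
  choose r hr using hrep
  have hint (f : RUCb G) (p : lusinMaps G) : Integrable (fun x => f.1 (p.1 x)) := by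
    obtain ⟨C, hC⟩ := f.2.1
    refine Integrable.of_bound (LusinMeasurable.comp_continuous p.2
      (mem_RUCb_iff.1 f.2).continuous).aestronglyMeasurable C (Eventually.of_forall fun x => hC _)
  have hmk (f : G → ℝ) (p : lusinMaps G) :
      ∫ x, f ((r (LZero.mk p)).1 x) = ∫ x, f (p.1 x) := by
    refine integral_congr_ae ?_
    filter_upwards [LZero.mk_eq_mk.1 (hr (LZero.mk p))] with x hx
    rw [hx]
  have hruc (f : RUCb G) : (fun h => ∫ x, f.1 ((r h).1 x)) ∈ RUCb (LZero G) := by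
    rw [mem_RUCb_iff]
    obtain ⟨⟨C, hC⟩, hf⟩ := mem_RUCb_iff.1 f.2
    have hC0 : 0 ≤ C := (abs_nonneg _).trans (hC 1)
    refine ⟨⟨C, fun h => ?_⟩, fun ε hε => ?_⟩
    · simpa using norm_integral_le_of_norm_le_const (μ := (volume : Measure I))
        (f := fun x => f.1 ((r h).1 x)) (Eventually.of_forall fun x => hC _)
    · obtain ⟨U, hU, hUo, hU1⟩ := eventually_nhds_iff.1 (hf (ε / 2) (half_pos hε))
      set η := ε / 2 / (2 * C + 1) with hη
      have hη0 : 0 < η := by positivity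
      have hN : LZero.basicNhd U (ENNReal.ofReal η) ∈ 𝓝 (1 : LZero G) :=
        LZero.hasBasis_nhds_one.mem_of_mem (i := (U, ENNReal.ofReal η))
          ⟨hUo, hU1, ENNReal.ofReal_pos.2 hη0⟩
      filter_upwards [hN] with u hu h
      obtain ⟨p, rfl⟩ := LZero.mk_surjective u
      obtain ⟨q, rfl⟩ := LZero.mk_surjective h
      rw [LZero.mk_mem_basicNhd] at hu
      rw [← map_mul, hmk, hmk, ← integral_sub (hint f _) (hint f _)]
      -- The measurable hull has the same measure and provides an integrable indicator.
      set S := toMeasurable volume {x : I | p.1 x ∉ U} with hS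
      have hSm : MeasurableSet S := measurableSet_toMeasurable _ _
      have hSv : volume.real S ≤ η := by
        refine ENNReal.toReal_le_of_le_ofReal hη0.le ?_
        rw [hS, measure_toMeasurable]
        exact hu.le
      have hbound (x : I) : |f.1 ((p * q).1 x) - f.1 (q.1 x)| ≤
          ε / 2 + S.indicator (fun _ => 2 * C) x := by
        by_cases hx : x ∈ S
        · rw [indicator_of_mem hx]
          have := (abs_sub (f.1 ((p * q).1 x)) (f.1 (q.1 x))).trans (add_le_add (hC _) (hC _))
          linarith
        · rw [indicator_of_notMem hx, add_zero]
          refine hU _ ?_ _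
          by_contra h
          exact hx (subset_toMeasurable _ _ h)
      have hi : Integrable (fun x : I => S.indicator (fun _ => 2 * C) x) :=
        (integrable_const _).indicator hSm
      rw [← Real.norm_eq_abs]
      refine (norm_integral_le_of_norm_le ((integrable_const (ε / 2)).add hi)
        (Eventually.of_forall hbound)).trans ?_
      rw [integral_add' (integrable_const _) hi, integral_indicator_const _ hSm]
      have h3 : η * (2 * C + 1) = ε / 2 := by
        rw [hη]
        field_simp
      simp only [integral_const, probReal_univ, smul_eq_mul]
      nlinarith [mul_le_mul_of_nonneg_right hSv (by positivity : 0 ≤ 2 * C)]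
  let Φ : RUCb G →ₗ[ℝ] RUCb (LZero G) :=
    { toFun := fun f => ⟨_, hruc f⟩
      map_add' := fun f g => Subtype.ext (funext fun h => integral_add (hint f _) (hint g _))
      map_smul' := fun c f => Subtype.ext (funext fun h => integral_const_mul c _) }
  refine ⟨m ∘ₗ Φ, fun f hf => hpos _ fun h => integral_nonneg fun x => hf _, ?_, fun g f => ?_⟩
  · rw [← hone]
    refine congrArg m (Subtype.ext (funext fun h => ?_))
    change ∫ _ : I, (1 : ℝ) = 1
    simp
  · let c : lusinMaps G := ⟨fun _ => g, fun _ _ => ⟨univ, isClosed_univ, by simp,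
      continuousOn_const⟩⟩
    rw [LinearMap.comp_apply, LinearMap.comp_apply, ← hinv (LZero.mk c) (Φ f)]
    refine congrArg m (Subtype.ext (funext fun h => ?_))
    obtain ⟨p, rfl⟩ := LZero.mk_surjective h
    change ∫ x, f.1 (g * (r (LZero.mk p)).1 x) = ∫ x, f.1 ((r (LZero.mk c * LZero.mk p)).1 x)
    rw [← map_mul, hmk, hmk fun y => f.1 (g * y)]
    rfl

end Amenable

/-! ### Lipschitz regularization for the Hamming distance -/

section HammingRegularization

variable {ι G : Type*} [Fintype ι] [DecidableEq G]

/-- The largest function below `F` that is `L`-Lipschitz for the Hamming distance. -/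
noncomputable def hammingInf (F : (ι → G) → ℝ) (L : ℝ) (k : ι → G) : ℝ :=
  ⨅ y, (F y + L * hammingDist k y)

variable {F : (ι → G) → ℝ} {L C : ℝ}

theorem neg_le_add_mul_hammingDist (hF : ∀ k, |F k| ≤ C) (hL : 0 ≤ L) (k y : ι → G) :
    -C ≤ F y + L * hammingDist k y :=
  le_add_of_le_of_nonneg (neg_le_of_abs_le (hF y)) (by positivity)

theorem bddBelow_add_mul_hammingDist (hF : ∀ k, |F k| ≤ C) (hL : 0 ≤ L) (k : ι → G) :
    BddBelow (range fun y => F y + L * hammingDist k y) :=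
  ⟨-C, forall_mem_range.2 (neg_le_add_mul_hammingDist hF hL k)⟩

theorem hammingInf_le (hF : ∀ k, |F k| ≤ C) (hL : 0 ≤ L) (k : ι → G) : hammingInf F L k ≤ F k :=
  (ciInf_le (bddBelow_add_mul_hammingDist hF hL k) k).trans_eq (by simp)

theorem abs_hammingInf_le (hF : ∀ k, |F k| ≤ C) (hL : 0 ≤ L) (k : ι → G) :
    |hammingInf F L k| ≤ C := by
  have : Nonempty (ι → G) := ⟨k⟩
  exact abs_le.2 ⟨le_ciInf fun y => neg_le_add_mul_hammingDist hF hL k y,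
    (hammingInf_le hF hL k).trans (le_of_abs_le (hF k))⟩

theorem abs_hammingInf_sub_le (hF : ∀ k, |F k| ≤ C) (hL : 0 ≤ L) (k l : ι → G) :
    |hammingInf F L k - hammingInf F L l| ≤ L * hammingDist k l := by
  have : Nonempty (ι → G) := ⟨k⟩
  have key (k l : ι → G) : hammingInf F L k ≤ hammingInf F L l + L * hammingDist k l := by
    rw [← sub_le_iff_le_add]
    refine le_ciInf fun y => sub_le_iff_le_add.2 ?_
    refine (ciInf_le (bddBelow_add_mul_hammingDist hF hL k) y).trans ?_
    have : (hammingDist k y : ℝ) ≤ hammingDist k l + hammingDist l y := by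
      exact_mod_cast hammingDist_triangle k l y
    nlinarith
  rw [abs_sub_le_iff]
  refine ⟨by linarith [key k l], ?_⟩
  rw [hammingDist_comm]
  linarith [key l k]

/-- Points `y` with `L * hammingDist k y ≥ 2 * C` cannot push the infimum below `F k`, since `F`
oscillates by at most `2 * C`; at all other points `F y` is within `ε` of `F k`. -/
theorem abs_sub_hammingInf_le (hF : ∀ k, |F k| ≤ C) (hL : 0 ≤ L) {ε : ℝ} (hε : 0 ≤ ε)
    (h : ∀ k y, L * hammingDist k y < 2 * C → |F k - F y| ≤ ε) (k : ι → G) :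
    |F k - hammingInf F L k| ≤ ε := by
  have : Nonempty (ι → G) := ⟨k⟩
  rw [abs_of_nonneg (sub_nonneg.2 (hammingInf_le hF hL k)), sub_le_comm]
  refine le_ciInf fun y => ?_
  rcases lt_or_ge (L * hammingDist k y) (2 * C) with h1 | h1
  · have := le_of_abs_le (h k y h1)
    have : 0 ≤ L * hammingDist k y := by positivity
    linarith
  · linarith [le_of_abs_le (hF k), neg_le_of_abs_le (hF y)]

end HammingRegularization

/-- Elements close to `1` move a continuous function on a compact space by little. -/
theorem eventually_abs_smul_sub_le {H X : Type*} [Group H] [TopologicalSpace H]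
    [TopologicalSpace X] [CompactSpace X] [MulAction H X] [ContinuousSMul H X] (φ : C(X, ℝ))
    {ε : ℝ} (hε : 0 < ε) : ∀ᶠ u in 𝓝 (1 : H), ∀ x, |φ (u • x) - φ x| ≤ ε := by
  -- Currying gives a continuous map `H → C(X, ℝ)`, and for compact `X` the target carries the sup
  -- norm.
  let Φ : C(H × X, ℝ) := ⟨fun p => φ (p.1 • p.2), by fun_prop⟩
  have h := Φ.curry.continuous.tendsto 1
  filter_upwards [h (Metric.closedBall_mem_nhds _ hε)] with u hu x
  have h1 := (ContinuousMap.dist_le hε.le).1 (Metric.mem_closedBall.1 hu) x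
  simpa [Φ, Real.dist_eq] using h1

/-! ### Orbit maps in `L²` and concentration -/

section L2

variable {X : Type*} [MeasurableSpace X] {μ : Measure X} [IsProbabilityMeasure μ]

theorem norm_toLp_sub_toLp_le {f g : X → ℝ} (hf : MemLp f 2 μ) (hg : MemLp g 2 μ) {c : ℝ}
    (hc : 0 ≤ c) (h : ∀ x, |f x - g x| ≤ c) : ‖hf.toLp f - hg.toLp g‖ ≤ c := by
  rw [← MemLp.toLp_sub]
  have := Lp.norm_le_of_ae_bound (f := (hf.sub hg).toLp (f - g)) hc <| by
    filter_upwards [(hf.sub hg).coeFn_toLp] with x hx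
    rw [hx]
    exact h x
  simpa [measureUnivNNReal] using this

theorem norm_toLp_le {f : X → ℝ} (hf : MemLp f 2 μ) {c : ℝ} (hc : 0 ≤ c) (h : ∀ x, |f x| ≤ c) :
    ‖hf.toLp f‖ ≤ c := by
  have := norm_toLp_sub_toLp_le hf (MemLp.zero' (ε := ℝ)) hc (by simpa using h)
  have h0 : (MemLp.zero' (ε := ℝ) : MemLp (fun _ : X => (0 : ℝ)) 2 μ).toLp = 0 := rfl
  rwa [h0, sub_zero] at this

end L2

section Concentration

variable {G : Type u} [Group G] [TopologicalSpace G] [IsTopologicalGroup G]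
  {X : Type*} [TopologicalSpace X] [CompactSpace X]
  [MulAction (LZero G) X] [ContinuousSMul (LZero G) X] [MeasurableSpace X] [BorelSpace X]
  (μ : Measure X) [IsProbabilityMeasure μ]

theorem memLp_smul (φ : C(X, ℝ)) (h : LZero G) : MemLp (fun x => φ (h • x)) 2 μ := by
  have hc : Continuous fun x => φ (h • x) := by fun_prop
  exact MemLp.of_bound hc.measurable.aestronglyMeasurable ‖φ‖
    (Eventually.of_forall fun x => φ.norm_coe_le_norm _)

/-- The orbit map of a continuous function in `L²`. -/
noncomputable def orbitLp (φ : C(X, ℝ)) (h : LZero G) : Lp ℝ 2 μ :=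
  (memLp_smul μ φ h).toLp

theorem norm_orbitLp_sub_le {φ : C(X, ℝ)} {h k : LZero G} {c : ℝ} (hc : 0 ≤ c)
    (hφ : ∀ x, |φ ((h * k⁻¹) • x) - φ x| ≤ c) : ‖orbitLp μ φ h - orbitLp μ φ k‖ ≤ c := by
  refine norm_toLp_sub_toLp_le _ _ hc fun x => ?_
  simpa [smul_smul] using hφ (k • x)

/-- Right multiplication by `k` precomposes both functions with the measure-preserving action of
`k`. -/
theorem norm_orbitLp_mul_right_sub [SMulInvariantMeasure (LZero G) X μ] (φ : C(X, ℝ))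
    (h h' k : LZero G) :
    ‖orbitLp μ φ (h * k) - orbitLp μ φ (h' * k)‖ = ‖orbitLp μ φ h - orbitLp μ φ h'‖ := by
  have h1 (h : LZero G) : (fun x => φ ((h * k) • x)) = (fun x => φ (h • x)) ∘ (k • ·) := by
    ext x
    simp [mul_smul]
  have hd := (memLp_smul μ φ h).sub (memLp_smul μ φ h')
  rw [orbitLp, orbitLp, orbitLp, orbitLp, ← MemLp.toLp_sub, ← MemLp.toLp_sub, Lp.norm_toLp,
    Lp.norm_toLp, ← eLpNorm_comp_measurePreserving hd.1 (measurePreserving_smul k μ), h1, h1]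
  rfl

theorem isRUC_norm_orbitLp_stepHom_sub (φ : C(X, ℝ)) (n : ℕ) (v : Lp ℝ 2 μ) :
    IsRUC fun k => ‖orbitLp μ φ (stepHom G n k) - v‖ := by
  refine ⟨⟨‖φ‖ + ‖v‖, fun k => ?_⟩, fun ε hε => ?_⟩
  · rw [abs_norm]
    refine (norm_sub_le _ _).trans (add_le_add_left (norm_toLp_le _ (norm_nonneg _) fun x => ?_) _)
    exact φ.norm_coe_le_norm _
  · filter_upwards [(tendsto_stepHom n).eventually (eventually_abs_smul_sub_le φ hε)] with u hu k
    refine (abs_norm_sub_norm_le _ _).trans ?_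
    rw [sub_sub_sub_cancel_right]
    refine norm_orbitLp_sub_le μ hε.le ?_
    rw [map_mul, mul_inv_cancel_right]
    exact hu

/-- Concentration: along fine subdivisions, orbit maps restricted to step maps are nearly constant
in mean. -/
theorem eventually_mean_norm_orbitLp_sub_le (m : Mean G) (φ : C(X, ℝ)) {ε : ℝ} (hε : 0 < ε) :
    ∀ᶠ n in atTop, ∃ v : Lp ℝ 2 μ,
      (m.pow (n + 1)).lin (fun k => ‖orbitLp μ φ (stepHom G n k) - v‖) ≤ ε := by
  classical
  obtain ⟨⟨U, η'⟩, ⟨-, hU1, hη'⟩, hU⟩ := LZero.hasBasis_nhds_one.mem_iff.1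
    (eventually_abs_smul_sub_le (H := LZero G) φ (div_pos hε three_pos))
  obtain ⟨η, hη, hηη'⟩ : ∃ η : ℝ, 0 < η ∧ ENNReal.ofReal η ≤ η' := by
    obtain ⟨r, hr, hr'⟩ := ENNReal.lt_iff_exists_nnreal_btwn.1 hη'
    exact ⟨r, by simpa using hr, by simpa using hr'.le⟩
  set C := ‖φ‖ + 1 with hC
  have hC0 : 0 < C := by positivity
  have hφ (x : X) : |φ x| ≤ C := (φ.norm_coe_le_norm x).trans (by linarith)
  have hlim : Tendsto (fun n : ℕ => (2 * C / η) ^ 2 * (1 / ((n : ℝ) + 1))) atTop (𝓝 0) := by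
    have := (tendsto_one_div_add_atTop_nhds_zero_nat (𝕜 := ℝ)).const_mul ((2 * C / η) ^ 2)
    rwa [mul_zero] at this
  filter_upwards [hlim.eventually (ge_mem_nhds (show 0 < (ε / 3) ^ 2 by positivity))] with n hn
  have hn0 : 0 < (n : ℝ) + 1 := by positivity
  -- With this slope, `L * d < 2 * C` says exactly that the normalized distance is below `η`, while
  -- `(n + 1) * L ^ 2` tends to `0`.
  set L := 2 * C / η / (n + 1) with hL
  have hL0 : 0 ≤ L := by positivity
  let F (x : X) (k : Fin (n + 1) → G) : ℝ := φ (stepHom G n k • x)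
  have hF (x : X) (k : Fin (n + 1) → G) : |F x k| ≤ C := hφ _
  have hFε (x : X) (k y : Fin (n + 1) → G) (hky : L * hammingDist k y < 2 * C) :
      |F x k - F x y| ≤ ε / 3 := by
    have h1 : (hammingDist k y : ℝ) / (n + 1) < η := by
      have h2 : L * hammingDist k y = 2 * C * ((hammingDist k y : ℝ) / (n + 1) / η) := by
        rw [hL]
        ring
      rw [h2, mul_lt_iff_lt_one_right (by positivity), div_lt_one hη] at hky
      exact hky
    obtain ⟨f, hf, hfη⟩ := stepHom_div_mem_basicNhd hU1 h1
    have := hU (show _ ∈ LZero.basicNhd U η' from ⟨f, hf, hfη.trans_le hηη'⟩) (stepHom G n y • x)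
    simpa [smul_smul] using this
  -- Regularization is done pointwise in `x`. The infimum may be uncountable, but an infimum of
  -- continuous functions is upper semicontinuous, hence Borel.
  have hmeas (k : Fin (n + 1) → G) : Measurable fun x => hammingInf (F x) L k := by
    refine UpperSemicontinuous.measurable (upperSemicontinuous_ciInf
      (fun x => bddBelow_add_mul_hammingDist (hF x) hL0 k) fun y => ?_)
    refine Continuous.upperSemicontinuous ?_
    fun_prop
  have hmem (k : Fin (n + 1) → G) : MemLp (fun x => hammingInf (F x) L k) 2 μ :=
    MemLp.of_bound (hmeas k).aestronglyMeasurable C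
      (Eventually.of_forall fun x => abs_hammingInf_le (hF x) hL0 k)
  let W (k : Fin (n + 1) → G) : Lp ℝ 2 μ := (hmem k).toLp
  have hW (k) : ‖W k‖ ≤ C := norm_toLp_le _ hC0.le fun x => abs_hammingInf_le (hF x) hL0 k
  have hES := m.pow_norm_sub_weak_sq_le hL0 (n + 1) W C hW fun k l =>
    norm_toLp_sub_toLp_le _ _ (by positivity) fun x => abs_hammingInf_sub_le (hF x) hL0 k l
  set v := (m.pow (n + 1)).weak W with hv
  refine ⟨v, ?_⟩
  have hpt (k : Fin (n + 1) → G) : ‖orbitLp μ φ (stepHom G n k) - v‖ ≤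
      ε / 2 + 3 / (2 * ε) * ‖W k - v‖ ^ 2 := by
    have h1 : ‖orbitLp μ φ (stepHom G n k) - W k‖ ≤ ε / 3 :=
      norm_toLp_sub_toLp_le _ _ (by positivity) fun x =>
        abs_sub_hammingInf_le (hF x) hL0 (by positivity) (hFε x) k
    have h2 := norm_sub_le_norm_sub_add_norm_sub (orbitLp μ φ (stepHom G n k)) (W k) v
    -- Completing the square replaces Cauchy–Schwarz in passing from the second moment to the first.
    have h3 : ‖W k - v‖ ≤ ε / 6 + 3 / (2 * ε) * ‖W k - v‖ ^ 2 := by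
      have h4 : ε / 6 + 3 / (2 * ε) * ‖W k - v‖ ^ 2 - ‖W k - v‖ =
          3 / (2 * ε) * (‖W k - v‖ - ε / 3) ^ 2 := by
        field_simp
        ring
      have : 0 ≤ 3 / (2 * ε) * (‖W k - v‖ - ε / 3) ^ 2 := by positivity
      linarith
    linarith
  have hb : ∀ k, |ε / 2 + 3 / (2 * ε) * ‖W k - v‖ ^ 2| ≤ ε / 2 + 3 / (2 * ε) * (C + ‖v‖) ^ 2 := by
    intro k
    rw [abs_of_nonneg (by positivity)]
    gcongr
    exact (norm_sub_le _ _).trans (by gcongr; exact hW k)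
  refine ((m.pow (n + 1)).mono (isRUC_norm_orbitLp_stepHom_sub μ φ n v).1 ⟨_, hb⟩ hpt).trans ?_
  have hsplit : (fun k => ε / 2 + 3 / (2 * ε) * ‖W k - v‖ ^ 2) =
      (fun _ => ε / 2) + (3 / (2 * ε)) • fun k => ‖W k - v‖ ^ 2 := rfl
  rw [hsplit, map_add, map_smul, Mean.map_const, smul_eq_mul]
  have h5 : ((n + 1 : ℕ) : ℝ) * L ^ 2 = (2 * C / η) ^ 2 * (1 / ((n : ℝ) + 1)) := by
    rw [hL]
    push_cast
    field_simp
  have h6 : (m.pow (n + 1)).lin (fun k => ‖W k - v‖ ^ 2) ≤ (ε / 3) ^ 2 :=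
    hES.trans (h5.trans_le hn)
  have h7 : 3 / (2 * ε) * (ε / 3) ^ 2 = ε / 6 := by
    field_simp
    norm_num
  have h8 := mul_le_mul_of_nonneg_left h6 (show 0 ≤ 3 / (2 * ε) by positivity)
  linarith

/-- For a step map `g` near `h`, the distance between the orbit vectors of `g` and `1` equals that
between those of `g * k` and `k`, for every step map `k`. Average over `k` and pass through the
centre `v`: by invariance both terms have the same small mean. -/
theorem orbitLp_eq [SMulInvariantMeasure (LZero G) X μ] (hG : IsAmenableGroup G) (φ : C(X, ℝ))
    (h : LZero G) : orbitLp μ φ h = orbitLp μ φ (1 : LZero G) := by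
  obtain ⟨m, hm⟩ := hG.exists_mean
  rw [← sub_eq_zero, ← norm_le_zero_iff]
  refine le_of_forall_pos_le_add fun ε hε => ?_
  have h3 : 0 < ε / 3 := by positivity
  obtain ⟨n, ⟨v, hv⟩, g, hg⟩ := ((eventually_mean_norm_orbitLp_sub_le μ m φ h3).and
    (eventually_exists_stepHom h (eventually_abs_smul_sub_le (H := LZero G) φ h3))).exists
  have h1 : ‖orbitLp μ φ h - orbitLp μ φ (stepHom G n g)‖ ≤ ε / 3 :=
    norm_orbitLp_sub_le μ h3.le hg
  set w : (Fin (n + 1) → G) → ℝ := fun k => ‖orbitLp μ φ (stepHom G n k) - v‖ with hw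
  have hruc : IsRUC w := isRUC_norm_orbitLp_stepHom_sub μ φ n v
  obtain ⟨D, hD⟩ := hruc.1
  have h2 : ‖orbitLp μ φ (stepHom G n g) - orbitLp μ φ (1 : LZero G)‖ ≤ 2 * (ε / 3) := by
    rw [← (m.pow (n + 1)).map_const ‖orbitLp μ φ (stepHom G n g) - orbitLp μ φ (1 : LZero G)‖]
    refine ((m.pow (n + 1)).mono (g := (fun k => w (g * k)) + w) ⟨_, fun _ => le_rfl⟩
      ⟨D + D, fun k => (abs_add_le _ _).trans (add_le_add (hD _) (hD _))⟩ fun k => ?_).trans ?_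
    · rw [← norm_orbitLp_mul_right_sub μ φ _ _ (stepHom G n k), one_mul, ← map_mul]
      refine (norm_sub_le_norm_sub_add_norm_sub _ v _).trans_eq ?_
      rw [norm_sub_rev v]
      rfl
    · rw [map_add, m.pow_invariant hm (n + 1) g w hruc]
      linarith
  have := norm_sub_le_norm_sub_add_norm_sub (orbitLp μ φ h) (orbitLp μ φ (stepHom G n g))
    (orbitLp μ φ (1 : LZero G))
  linarith

/-- Invariant measures of `L⁰(G)` are supported on the fixed points, for `G` amenable. -/
theorem measure_compl_fixedPoints_eq_zero [T2Space X] [μ.Regular]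
    [SMulInvariantMeasure (LZero G) X μ] (hG : IsAmenableGroup G) :
    μ (MulAction.fixedPoints (LZero G) X)ᶜ = 0 := by
  have hopen : IsOpen (MulAction.fixedPoints (LZero G) X)ᶜ := by
    have : MulAction.fixedPoints (LZero G) X = ⋂ h : LZero G, {x | h • x = x} := by
      ext
      simp
    rw [this]
    exact (isClosed_iInter fun h => isClosed_eq (by fun_prop) continuous_id).isOpen_compl
  -- Each `h` gives a null set, but there may be uncountably many `h`. On compact sets it suffices
  -- that every point has a null neighbourhood; a function separating `x` from `h • x` supplies one.
  rw [hopen.measure_eq_iSup_isCompact]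
  simp only [ENNReal.iSup_eq_zero]
  intro K hKsub hK
  refine hK.measure_zero_of_nhdsWithin fun x hx => ?_
  obtain ⟨h, hhx⟩ : ∃ h : LZero G, h • x ≠ x := by
    simpa [MulAction.mem_fixedPoints] using hKsub hx
  obtain ⟨φ, hφ0, hφ1, -⟩ := exists_continuous_zero_one_of_isClosed (isClosed_singleton (x := x))
    (isClosed_singleton (x := h • x)) (by simpa using hhx.symm)
  refine ⟨{y | φ (h • y) ≠ φ ((1 : LZero G) • y)}, mem_nhdsWithin_of_mem_nhds ?_, ?_⟩
  · refine (isOpen_ne_fun (by fun_prop) (by fun_prop)).mem_nhds ?_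
    have h0 := hφ0 rfl
    have h1 := hφ1 rfl
    simp_all
  · exact ae_iff.1 ((MemLp.toLp_eq_toLp_iff _ _).1 (orbitLp_eq μ hG φ h))

end Concentration

/-! ### Invariant measures and the space of means -/

theorem isRUC_orbit {H : Type u} [Group H] [TopologicalSpace H] {X : Type*}
    [TopologicalSpace X] [CompactSpace X] [MulAction H X] [ContinuousSMul H X] (φ : C(X, ℝ)) (x : X) :
    IsRUC fun h : H => φ (h • x) := by
  refine ⟨⟨‖φ‖, fun h => φ.norm_coe_le_norm _⟩, fun ε hε => ?_⟩
  filter_upwards [eventually_abs_smul_sub_le (H := H) φ hε] with u hu h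
  rw [mul_smul]
  exact hu _

section General

open scoped CompactlySupported

variable {H : Type u} [Group H] [TopologicalSpace H] [IsTopologicalGroup H]

/-- Amenable groups have invariant regular probability measures on their compact spaces. -/
theorem IsAmenableGroup.exists_invariant_measure (hH : IsAmenableGroup H) (X : Type*)
    [TopologicalSpace X] [CompactSpace X] [T2Space X] [Nonempty X] [MulAction H X]
    [ContinuousSMul H X] [MeasurableSpace X] [BorelSpace X] :
    ∃ μ : Measure X, IsProbabilityMeasure μ ∧ μ.Regular ∧ SMulInvariantMeasure H X μ := by
  obtain ⟨m, hm⟩ := hH.exists_mean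
  obtain ⟨x₀⟩ := ‹Nonempty X›
  -- The mean is pushed forward along the orbit of `x₀`.
  let Λ : C_c(X, ℝ) →ₚ[ℝ] ℝ :=
    { toFun := fun φ => m.lin fun h => φ (h • x₀)
      map_add' := fun φ ψ => map_add m.lin _ _
      map_smul' := fun c φ => map_smul m.lin _ _
      monotone' := fun φ ψ hφψ => m.mono (isRUC_orbit φ.toContinuousMap x₀).1
        (isRUC_orbit ψ.toContinuousMap x₀).1 fun h => hφψ _ }
  set μ := RealRMK.rieszMeasure Λ with hμ
  have hint (φ : C(X, ℝ)) : ∫ x, φ x ∂μ = m.lin fun h => φ (h • x₀) :=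
    RealRMK.integral_rieszMeasure Λ (CompactlySupportedContinuousMap.continuousMapEquiv φ)
  refine ⟨μ, ?_, inferInstance, ⟨fun g s hs => ?_⟩⟩
  · have h1 := hint 1
    simp only [ContinuousMap.one_apply, integral_const, smul_eq_mul, mul_one, m.map_one] at h1
    constructor
    rw [← ENNReal.toReal_eq_one_iff]
    exact h1
  · have hreg : (μ.map (Homeomorph.smul g)).Regular := Measure.Regular.map _
    have hmap : μ.map (Homeomorph.smul g) = μ := by
      refine Measure.ext_of_integral_eq_on_compactlySupported fun φ => ?_
      refine (integral_map_equiv (Homeomorph.smul g).toMeasurableEquiv φ).trans ?_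
      refine (hint (φ.toContinuousMap.comp ⟨fun x => g • x, by fun_prop⟩)).trans ?_
      refine Eq.trans ?_ ((hm g _ (isRUC_orbit φ.toContinuousMap x₀)).trans
        (hint φ.toContinuousMap).symm)
      congr 1
      ext h
      simp [mul_smul]
    conv_rhs => rw [← hmap]
    rw [Measure.map_apply (Homeomorph.smul g).measurable hs]
    rfl

/-- Some invariant probability measure exists, and it could not live on an empty set of fixed
points. -/
theorem IsWhirlyAmenable.isExtremelyAmenable (h : IsWhirlyAmenable.{u, v} H) :
    IsExtremelyAmenable.{u, v} H := by
  intro X _ _ _ _ _ _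
  let : MeasurableSpace X := borel X
  have : BorelSpace X := ⟨rfl⟩
  obtain ⟨μ, h1, h2, h3⟩ := h.1.exists_invariant_measure X
  by_contra hne
  have := h.2 X μ
  rw [not_nonempty_iff_eq_empty.1 hne, compl_empty, measure_univ] at this
  exact one_ne_zero this

variable (H) in
/-- The space of means on `RUC_b(H)`. -/
def RUCbMean : Type u :=
  {p : RUCb H → ℝ // (∀ f g, p (f + g) = p f + p g) ∧ (∀ (c : ℝ) f, p (c • f) = c * p f) ∧
    (∀ f, (∀ x, 0 ≤ f.1 x) → 0 ≤ p f) ∧ p RUCb.one = 1}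

namespace RUCbMean

instance : TopologicalSpace (RUCbMean H) := instTopologicalSpaceSubtype

instance : T2Space (RUCbMean H) := inferInstanceAs (T2Space (Subtype _))

instance : Nonempty (RUCbMean H) :=
  ⟨⟨fun f => f.1 1, fun _ _ => rfl, fun _ _ => rfl, fun _ hf => hf 1, rfl⟩⟩

theorem abs_sub_le (p : RUCbMean H) {f g : RUCb H} {c : ℝ} (h : ∀ x, |f.1 x - g.1 x| ≤ c) :
    |p.1 f - p.1 g| ≤ c := by
  obtain ⟨p, hadd, hsmul, hpos, hone⟩ := p
  have key (f g : RUCb H) (h : ∀ x, f.1 x - g.1 x ≤ c) : p f - p g ≤ c := by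
    have h1 := hpos (c • RUCb.one + (g + (-1 : ℝ) • f)) fun x => by
      change 0 ≤ c * 1 + (g.1 x + -1 * f.1 x)
      linarith [h x]
    rw [hadd, hadd, hsmul, hsmul, hone] at h1
    linarith
  exact abs_sub_le_iff.2 ⟨key f g fun x => (abs_sub_le_iff.1 (h x)).1,
    key g f fun x => (abs_sub_le_iff.1 (h x)).2⟩

instance : CompactSpace (RUCbMean H) := by
  refine isCompact_iff_compactSpace.1 (?_ : IsCompact {p : RUCb H → ℝ |
    (∀ f g, p (f + g) = p f + p g) ∧ (∀ (c : ℝ) f, p (c • f) = c * p f) ∧ (∀ f, (∀ x, 0 ≤ f.1 x) → 0 ≤ p f) ∧ p RUCb.one = 1})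
  have hbd (f : RUCb H) : ∃ C : ℝ, ∀ x, |f.1 x| ≤ C := f.2.1
  choose C hC using hbd
  -- Tychonoff: means form a closed subset of a product of intervals.
  refine (isCompact_univ_pi fun f => isCompact_Icc (a := -C f) (b := C f)).of_isClosed_subset ?_
    fun p hp f _ => ?_
  · simp only [ofPred_and, ofPred_forall]
    refine .inter ?_ (.inter ?_ (.inter ?_ ?_))
    · exact isClosed_iInter fun f => isClosed_iInter fun g => isClosed_eq (by fun_prop) (by fun_prop)
    · exact isClosed_iInter fun c => isClosed_iInter fun f => isClosed_eq (by fun_prop) (by fun_prop)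
    · exact isClosed_iInter fun f => isClosed_iInter fun _ => isClosed_le (by fun_prop) (by fun_prop)
    · exact isClosed_eq (by fun_prop) (by fun_prop)
  · have h0 : p 0 = 0 := by simpa using hp.2.1 0 0
    have : |p f - p 0| ≤ C f := abs_sub_le ⟨p, hp⟩ (f := f) (g := 0) (c := C f) fun x => by
      change |f.1 x - 0| ≤ C f
      rw [sub_zero]
      exact hC f x
    rw [h0, sub_zero] at this
    exact abs_le.1 this

instance : MulAction H (RUCbMean H) where
  smul h p := ⟨fun f => p.1 (RUCb.translate h f),
    fun f g => p.2.1 (RUCb.translate h f) (RUCb.translate h g),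
    fun c f => p.2.2.1 c (RUCb.translate h f),
    fun _ hf => p.2.2.2.1 _ fun _ => hf _, p.2.2.2.2⟩
  one_smul p := Subtype.ext <| funext fun f =>
    congrArg p.1 (Subtype.ext <| funext fun x => congrArg f.1 (one_mul x))
  mul_smul g h p := Subtype.ext <| funext fun f =>
    congrArg p.1 (Subtype.ext <| funext fun x => congrArg f.1 (mul_assoc g h x))

instance : ContinuousSMul H (RUCbMean H) where
  continuous_smul := by
    refine continuous_induced_rng.2 (continuous_pi fun f => ?_)
    rw [continuous_iff_continuousAt]
    rintro ⟨h, p⟩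
    rw [ContinuousAt, Metric.nhds_basis_closedBall.tendsto_right_iff]
    intro ε hε
    have h1 : Tendsto (fun q : H × RUCbMean H => q.1 * h⁻¹) (𝓝 (h, p)) (𝓝 1) := by
      have : Continuous fun q : H × RUCbMean H => q.1 * h⁻¹ := by fun_prop
      simpa using this.tendsto (h, p)
    have h2 : Continuous fun q : H × RUCbMean H => q.2.1 (RUCb.translate h f) :=
      (continuous_apply _).comp (continuous_subtype_val.comp continuous_snd)
    filter_upwards [h1.eventually ((mem_RUCb_iff.1 f.2).2 (ε / 2) (half_pos hε)),
      h2.tendsto (h, p) (Metric.closedBall_mem_nhds _ (half_pos hε))] with q hq1 hq2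
    -- This bound is uniform over all means, which upgrades separate to joint continuity.
    have h3 : |q.2.1 (RUCb.translate q.1 f) - q.2.1 (RUCb.translate h f)| ≤ ε / 2 :=
      q.2.abs_sub_le fun x => by
        have := hq1 (h * x)
        rwa [← mul_assoc, inv_mul_cancel_right] at this
    rw [mem_preimage, Metric.mem_closedBall, Real.dist_eq] at hq2
    rw [Metric.mem_closedBall, Real.dist_eq]
    refine (_root_.abs_sub_le _ (q.2.1 (RUCb.translate h f)) _).trans ?_
    refine (add_le_add h3 hq2).trans_eq (add_halves ε)

end RUCbMean

/-- A fixed point in the space of means is an invariant mean; `ULift` only adjusts the universe. -/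
theorem IsExtremelyAmenable.isAmenableGroup (h : IsExtremelyAmenable.{u, v} H) :
    IsAmenableGroup H := by
  have : CompactSpace (ULift.{v} (RUCbMean H)) := Homeomorph.ulift.symm.compactSpace
  have : ContinuousSMul H (ULift.{v} (RUCbMean H)) :=
    ⟨continuous_uliftUp.comp (continuous_fst.smul (continuous_uliftDown.comp continuous_snd))⟩
  obtain ⟨⟨p⟩, hp⟩ := h (ULift.{v} (RUCbMean H))
  refine ⟨⟨⟨p.1, p.2.1⟩, p.2.2.1⟩, p.2.2.2.1, p.2.2.2.2, fun g f => ?_⟩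
  exact congrFun (congrArg Subtype.val (congrArg ULift.down (hp g))) f

end General

theorem theorem1p1 (G : Type u) [Group G] [TopologicalSpace G] [IsTopologicalGroup G] :
    List.TFAE [
      IsAmenableGroup G,
      IsAmenableGroup (LZero G),
      IsExtremelyAmenable.{u, v} (LZero G),
      IsWhirlyAmenable.{u, v} (LZero G)] := by
  tfae_have 1 → 4 := fun h => ⟨h.lZero, fun _ _ _ _ _ _ _ _ μ _ _ _ =>
    measure_compl_fixedPoints_eq_zero μ h⟩
  tfae_have 4 → 3 := IsWhirlyAmenable.isExtremelyAmenable
  tfae_have 3 → 2 := IsExtremelyAmenable.isAmenableGroup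
  tfae_have 2 → 1 := IsAmenableGroup.of_lZero
  tfae_finish
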